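/- Let $(M,g)$ be a smooth $n$-dimensional pseudo-Riemannian manifold with Levi-Civita connection $\nabla$, and let $\varepsilon\in\{1,-1\}$. Let $\varphi$ be a smooth $(1,1)$-tensor field, $\xi$ a smooth vector field and $\eta$ a smooth $1$-form on $M$ with $$\varphi^2=I-\eta\otimes\xi,\quad \eta(\xi)=1,\quad \varphi\xi=0,\quad \eta\circ\varphi=0,\quad g(\varphi X,\varphi Y)=g(X,Y)-\varepsilon\,\eta(X)\eta(Y),$$ and suppose that $(\varphi,\xi,\eta,g,\varepsilon)$ is an $(\varepsilon)$-para Sasakian structure, i.e. $$(\nabla_X\varphi)Y=-g(\varphi X,\varphi Y)\,\xi-\varepsilon\,\eta(Y)\,\varphi^2X$$ for all vector fields $X,Y$. Let $f,\lambda,\mu$ be smooth real functions on $M$ such that $\xi=\mathrm{grad}\,f$ and $$\mathrm{Hess}(f)+S+\lambda g+\mu\,\eta\otimes\eta=0,$$ where $\mathrm{Hess}(f)(X,Y)=g(\nabla_X\,\mathrm{grad} f,Y)$, $S(Y,Z)=\mathrm{trace}\,(X\mapsto R(X,Y)Z)$ is the Ricci tensor, and $R(X,Y)Z=\nabla_X\nabla_YZ-\nabla_Y\nabla_XZ-\nabla_{[X,Y]}Z$;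 that is, $(\xi,\lambda,\mu)$ is a gradient almost $\eta$-Ricci soliton on $(M,g)$. (Since $g(\xi,\cdot)=\varepsilon\eta$, the condition $\xi=\mathrm{grad}\, f$ means $\eta=\varepsilon\,df$, so $\eta=df$ when $\varepsilon=1$.) Then at every point of $M$ $$n-1+\mu^2-\frac{(\Delta f+\varepsilon\mu)^2}{n}\ \le\ |S|^2\ \le\ n-1+\mu^2+\frac{\mathrm{scal}^2}{n},$$ where $\Delta f=\mathrm{div}(\mathrm{grad}\,f)$, $\mathrm{scal}=g^{ij}S_{ij}$ is the scalar curvature and $|S|^2=g^{ik}g^{jl}S_{ij}S_{kl}$. -/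

import Mathlib

open Bundle Module VectorField
open scoped Manifold ContDiff Topology

noncomputable section

/-- A smooth pseudo-Riemannian metric on an `n`-dimensional manifold `M`: a smooth field of
symmetric nondegenerate bilinear forms on the tangent spaces (of arbitrary signature). -/
structure PseudoRiemannianMetric (n : ℕ) (M : Type*) [TopologicalSpace M]
    [ChartedSpace (EuclideanSpace ℝ (Fin n)) M] [IsManifold (𝓡 n) ∞ M] where
  /-- The bilinear form on each tangent space. -/
  inner (p : M) : TangentSpace (𝓡 n) p →L[ℝ] TangentSpace (𝓡 n) p →L[ℝ] ℝ
  symm (p : M) (v w : TangentSpace (𝓡 n) p) : inner p v w = inner p w v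
  nondegenerate (p : M) (v : TangentSpace (𝓡 n) p) (hv : ∀ w, inner p v w = 0) : v = 0
  contMDiff : ContMDiff (𝓡 n)
    ((𝓡 n).prod 𝓘(ℝ, EuclideanSpace ℝ (Fin n) →L[ℝ] EuclideanSpace ℝ (Fin n) →L[ℝ] ℝ)) ∞
    (fun p ↦ TotalSpace.mk' (EuclideanSpace ℝ (Fin n) →L[ℝ] EuclideanSpace ℝ (Fin n) →L[ℝ] ℝ)
      p (inner p))

namespace PseudoRiemannianMetric

variable {n : ℕ} {M : Type*} [TopologicalSpace M]
  [ChartedSpace (EuclideanSpace ℝ (Fin n)) M] [IsManifold (𝓡 n) ∞ M]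
  (g : PseudoRiemannianMetric n M)

instance instFiniteDimensionalTangent (p : M) : FiniteDimensional ℝ (TangentSpace (𝓡 n) p) :=
  inferInstanceAs (FiniteDimensional ℝ (EuclideanSpace ℝ (Fin n)))

instance instT2SpaceTangent (p : M) : T2Space (TangentSpace (𝓡 n) p) :=
  inferInstanceAs (T2Space (EuclideanSpace ℝ (Fin n)))

/-- The function `p ↦ g_p(X_p, Y_p)`. -/
def pairing (X Y : Π p : M, TangentSpace (𝓡 n) p) (p : M) : ℝ := g.inner p (X p) (Y p)

lemma pairing_mdifferentiableAt {X Y : Π p : M, TangentSpace (𝓡 n) p} {p : M}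
    (hX : MDifferentiableAt (𝓡 n) (𝓡 n).tangent (T% X) p) (hY : MDifferentiableAt (𝓡 n) (𝓡 n).tangent (T% Y) p) : MDifferentiableAt (𝓡 n) 𝓘(ℝ) (g.pairing X Y) p := by
  have h := (g.contMDiff.mdifferentiable (by simp)) p
  have : MDifferentiableAt (𝓡 n) ((𝓡 n).prod 𝓘(ℝ))
      (fun q ↦ TotalSpace.mk' ℝ (E := Bundle.Trivial M ℝ) q (g.inner q (X q) (Y q))) p := by
    rw [← mdifferentiableWithinAt_univ] at h hX hY ⊢
    exact MDifferentiableWithinAt.clm_bundle_apply₂ (F₁ := EuclideanSpace ℝ (Fin n))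
      (F₂ := EuclideanSpace ℝ (Fin n)) h hX hY
  rw [mdifferentiableAt_totalSpace] at this
  exact this.2

/-- The musical isomorphism `v ↦ g_p(v, ·)` from the tangent space to its dual. -/
def flat (p : M) : TangentSpace (𝓡 n) p ≃ₗ[ℝ] Dual ℝ (TangentSpace (𝓡 n) p) :=
  LinearMap.linearEquivOfInjective
    ((ContinuousLinearMap.coeLM ℝ).comp (g.inner p).toLinearMap)
    (by
      rw [← LinearMap.ker_eq_bot, LinearMap.ker_eq_bot']
      intro v hv
      exact g.nondegenerate p v fun w ↦ by simpa using LinearMap.congr_fun hv w)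
    (Subspace.dual_finrank_eq).symm

/-- The musical isomorphism `♯`: `g_p(♯α, w) = α(w)`. -/
def sharp (p : M) (α : Dual ℝ (TangentSpace (𝓡 n) p)) : TangentSpace (𝓡 n) p :=
  (g.flat p).symm α

lemma inner_sharp (p : M) (α : Dual ℝ (TangentSpace (𝓡 n) p)) (w : TangentSpace (𝓡 n) p) :
    g.inner p (g.sharp p α) w = α w :=
  LinearMap.congr_fun ((g.flat p).apply_symm_apply α) w

lemma sharp_flat (p : M) (v : TangentSpace (𝓡 n) p) : g.sharp p (g.inner p v).toLinearMap = v :=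
  (g.flat p).symm_apply_apply v

/-! ### The Levi-Civita connection -/

/-- The right-hand side of the Koszul formula, which equals `2 g(∇_X Y, Z)`. -/
def koszul (X Y Z : Π p : M, TangentSpace (𝓡 n) p) (p : M) : ℝ :=
  mvfderiv (𝓡 n) (g.pairing Y Z) p (X p) + mvfderiv (𝓡 n) (g.pairing X Z) p (Y p) - mvfderiv (𝓡 n) (g.pairing X Y) p (Z p)
    + g.inner p (mlieBracket (𝓡 n) X Y p) (Z p)
    - g.inner p (mlieBracket (𝓡 n) X Z p) (Y p)
    - g.inner p (mlieBracket (𝓡 n) Y Z p) (X p)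

lemma pairing_comm (X Y : Π p : M, TangentSpace (𝓡 n) p) : g.pairing X Y = g.pairing Y X :=
  funext fun p ↦ g.symm p (X p) (Y p)

lemma pairing_smul_left (f : M → ℝ) (X Y : Π p : M, TangentSpace (𝓡 n) p) :
    g.pairing (f • X) Y = f * g.pairing X Y := by
  ext p; simp [pairing]

lemma pairing_add_left (X X' Y : Π p : M, TangentSpace (𝓡 n) p) :
    g.pairing (X + X') Y = g.pairing X Y + g.pairing X' Y := by
  ext p; simp [pairing]

lemma pairing_smul_right (f : M → ℝ) (X Y : Π p : M, TangentSpace (𝓡 n) p) :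
    g.pairing X (f • Y) = f * g.pairing X Y := by
  ext p; simp [pairing]

lemma pairing_add_right (X Y Y' : Π p : M, TangentSpace (𝓡 n) p) :
    g.pairing X (Y + Y') = g.pairing X Y + g.pairing X Y' := by
  ext p; simp [pairing]

instance instIsManifoldTwo : IsManifold (𝓡 n) 2 M :=
  IsManifold.of_le (n := ∞) (WithTop.coe_le_coe.2 le_top)

lemma koszul_tensorial_left {Y Z : Π p : M, TangentSpace (𝓡 n) p} {p : M}
    (hY : MDifferentiableAt (𝓡 n) (𝓡 n).tangent (T% Y) p) (hZ : MDifferentiableAt (𝓡 n) (𝓡 n).tangent (T% Z) p) :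
    TensorialAt (𝓡 n) (EuclideanSpace ℝ (Fin n)) (g.koszul · Y Z p) p where
  smul {f X} hf hX := by
    simp only [koszul, pairing_smul_left, mvfderiv_mul hf (g.pairing_mdifferentiableAt hX hZ),
      mvfderiv_mul hf (g.pairing_mdifferentiableAt hX hY), mlieBracket_smul_left hf hX]
    simp [pairing]
    ring
  add {X X'} hX hX' := by
    simp only [koszul, pairing_add_left,
      mvfderiv_add (g.pairing_mdifferentiableAt hX hZ) (g.pairing_mdifferentiableAt hX' hZ),
      mvfderiv_add (g.pairing_mdifferentiableAt hX hY) (g.pairing_mdifferentiableAt hX' hY),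
      mlieBracket_add_left hX hX']
    simp
    ring

lemma koszul_tensorial_right {X Y : Π p : M, TangentSpace (𝓡 n) p} {p : M}
    (hX : MDifferentiableAt (𝓡 n) (𝓡 n).tangent (T% X) p) (hY : MDifferentiableAt (𝓡 n) (𝓡 n).tangent (T% Y) p) :
    TensorialAt (𝓡 n) (EuclideanSpace ℝ (Fin n)) (g.koszul X Y · p) p where
  smul {f Z} hf hZ := by
    simp only [koszul, pairing_smul_right, mvfderiv_mul hf (g.pairing_mdifferentiableAt hX hZ),
      mvfderiv_mul hf (g.pairing_mdifferentiableAt hY hZ), mlieBracket_smul_right hf hZ]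
    simp [pairing, g.symm p (Z p)]
    ring
  add {Z Z'} hZ hZ' := by
    simp only [koszul, pairing_add_right,
      mvfderiv_add (g.pairing_mdifferentiableAt hX hZ) (g.pairing_mdifferentiableAt hX hZ'),
      mvfderiv_add (g.pairing_mdifferentiableAt hY hZ) (g.pairing_mdifferentiableAt hY hZ'),
      mlieBracket_add_right hZ hZ']
    simp
    ring

/-- For a vector field `Y` differentiable at `p`, the bilinear form
`(v, w) ↦ 2 g(∇_v Y, w)` on the tangent space at `p`. -/
def koszulForm (Y : Π p : M, TangentSpace (𝓡 n) p) (p : M) (hY : MDifferentiableAt (𝓡 n) (𝓡 n).tangent (T% Y) p) :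
    TangentSpace (𝓡 n) p →L[ℝ] TangentSpace (𝓡 n) p →L[ℝ] ℝ :=
  TensorialAt.mkHom₂ (I := 𝓡 n) (F := EuclideanSpace ℝ (Fin n)) (F' := EuclideanSpace ℝ (Fin n))
    (fun X Z ↦ g.koszul X Y Z p) p
    (fun _ hZ ↦ g.koszul_tensorial_left hY hZ) (fun _ hX ↦ g.koszul_tensorial_right hX hY)

lemma koszulForm_apply {X Y Z : Π p : M, TangentSpace (𝓡 n) p} {p : M}
    (hX : MDifferentiableAt (𝓡 n) (𝓡 n).tangent (T% X) p) (hY : MDifferentiableAt (𝓡 n) (𝓡 n).tangent (T% Y) p) (hZ : MDifferentiableAt (𝓡 n) (𝓡 n).tangent (T% Z) p) :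
    g.koszulForm Y p hY (X p) (Z p) = g.koszul X Y Z p :=
  TensorialAt.mkHom₂_apply _ _ hX hZ

open scoped Classical in
/-- `v ↦ ∇_v Y` at `p`, characterised by `2 g(∇_v Y, w) = koszulForm Y v w`; it is given the value
`0` where `Y` is not differentiable. -/
def nablaAux (Y : Π p : M, TangentSpace (𝓡 n) p) (p : M) :
    TangentSpace (𝓡 n) p →L[ℝ] TangentSpace (𝓡 n) p :=
  if hY : MDifferentiableAt (𝓡 n) (𝓡 n).tangent (T% Y) p then
    LinearMap.toContinuousLinearMap
      ((g.flat p).symm.toLinearMap ∘ₗ (ContinuousLinearMap.coeLM ℝ) ∘ₗ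
        ((1 / 2 : ℝ) • g.koszulForm Y p hY).toLinearMap)
  else 0

lemma inner_nablaAux {X Y Z : Π p : M, TangentSpace (𝓡 n) p} {p : M}
    (hX : MDifferentiableAt (𝓡 n) (𝓡 n).tangent (T% X) p) (hY : MDifferentiableAt (𝓡 n) (𝓡 n).tangent (T% Y) p) (hZ : MDifferentiableAt (𝓡 n) (𝓡 n).tangent (T% Z) p) :
    g.inner p (g.nablaAux Y p (X p)) (Z p) = 1 / 2 * g.koszul X Y Z p := by
  rw [nablaAux, dif_pos hY, ← g.koszulForm_apply hX hY hZ]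
  exact g.inner_sharp p _ (Z p)

lemma eq_of_inner_extend {p : M} {u v : TangentSpace (𝓡 n) p}
    (h : ∀ Z : Π p : M, TangentSpace (𝓡 n) p, MDifferentiableAt (𝓡 n) (𝓡 n).tangent (T% Z) p →
      g.inner p u (Z p) = g.inner p v (Z p)) : u = v := by
  rw [← sub_eq_zero]
  refine g.nondegenerate p _ fun w ↦ ?_
  have := h (FiberBundle.extend (EuclideanSpace ℝ (Fin n)) w)
    (FiberBundle.mdifferentiableAt_extend ..)
  simp only [FiberBundle.extend_apply_self] at this
  simp [this]

/-- The Levi-Civita connection of `g`, defined by the Koszul formula. In the notation of Mathlib,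
`g.leviCivita Y p v` is `∇_v Y` at `p`. -/
def leviCivita : CovariantDerivative (𝓡 n) (EuclideanSpace ℝ (Fin n))
    (TangentSpace (𝓡 n) : M → Type _) where
  toFun := g.nablaAux
  isCovariantDerivativeOnUniv :=
    { add := by
        intro Y Y' p hY hY' _
        have hs : MDifferentiableAt (𝓡 n) (𝓡 n).tangent (T% (Y + Y')) p := mdifferentiableAt_add_section hY hY'
        ext1 v
        refine g.eq_of_inner_extend fun Z hZ ↦ ?_
        obtain ⟨X, hX, rfl⟩ : ∃ X : Π p : M, TangentSpace (𝓡 n) p, MDifferentiableAt (𝓡 n) (𝓡 n).tangent (T% X) p ∧ X p = v :=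
          ⟨FiberBundle.extend (EuclideanSpace ℝ (Fin n)) v, FiberBundle.mdifferentiableAt_extend .., by simp⟩
        have e : g.inner p ((g.nablaAux Y p + g.nablaAux Y' p) (X p)) (Z p) =
            g.inner p (g.nablaAux Y p (X p)) (Z p) + g.inner p (g.nablaAux Y' p (X p)) (Z p) := by
          simp
        rw [e, g.inner_nablaAux hX hs hZ, g.inner_nablaAux hX hY hZ, g.inner_nablaAux hX hY' hZ]
        simp only [koszul, pairing_add_left, pairing_add_right,
          mvfderiv_add (g.pairing_mdifferentiableAt hX hY) (g.pairing_mdifferentiableAt hX hY'),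
          mvfderiv_add (g.pairing_mdifferentiableAt hY hZ) (g.pairing_mdifferentiableAt hY' hZ),
          mlieBracket_add_right hY hY', mlieBracket_add_left hY hY']
        simp
        ring
      leibniz := by
        intro Y f p hY hf _
        have hs : MDifferentiableAt (𝓡 n) (𝓡 n).tangent (T% (f • Y)) p := hf.smul_section hY
        ext1 v
        refine g.eq_of_inner_extend fun Z hZ ↦ ?_
        obtain ⟨X, hX, rfl⟩ : ∃ X : Π p : M, TangentSpace (𝓡 n) p, MDifferentiableAt (𝓡 n) (𝓡 n).tangent (T% X) p ∧ X p = v :=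
          ⟨FiberBundle.extend (EuclideanSpace ℝ (Fin n)) v, FiberBundle.mdifferentiableAt_extend .., by simp⟩
        have e : g.inner p ((f p • g.nablaAux Y p + (mvfderiv (𝓡 n) f p).smulRight (Y p)) (X p)) (Z p) =
            f p * g.inner p (g.nablaAux Y p (X p)) (Z p)
              + mvfderiv (𝓡 n) f p (X p) * g.inner p (Y p) (Z p) := by
          simp
        rw [e, g.inner_nablaAux hX hs hZ, g.inner_nablaAux hX hY hZ]
        simp only [koszul, pairing_smul_left, pairing_smul_right,
          mvfderiv_mul hf (g.pairing_mdifferentiableAt hX hY),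
          mvfderiv_mul hf (g.pairing_mdifferentiableAt hY hZ),
          mlieBracket_smul_right hf hY, mlieBracket_smul_left hf hY]
        simp [pairing, g.symm p (Y p) (X p)]
        ring }

/-- The Levi-Civita connection is torsion-free. -/
lemma leviCivita_torsion : (g.leviCivita).torsion = 0 := by
  rw [CovariantDerivative.torsion_eq_zero_iff]
  intro X Y p hX hY
  refine g.eq_of_inner_extend fun Z hZ ↦ ?_
  have e : g.inner p (g.nablaAux Y p (X p) - g.nablaAux X p (Y p)) (Z p) =
      g.inner p (g.nablaAux Y p (X p)) (Z p) - g.inner p (g.nablaAux X p (Y p)) (Z p) := by simp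
  refine e.trans ?_
  rw [g.inner_nablaAux hX hY hZ, g.inner_nablaAux hY hX hZ]
  simp only [koszul, g.pairing_comm Y X, mlieBracket_swap_apply (V := Y) (W := X)]
  simp
  ring

/-- The Levi-Civita connection is compatible with the metric. -/
lemma leviCivita_metric {X Y Z : Π p : M, TangentSpace (𝓡 n) p} {p : M}
    (hX : MDifferentiableAt (𝓡 n) (𝓡 n).tangent (T% X) p)
    (hY : MDifferentiableAt (𝓡 n) (𝓡 n).tangent (T% Y) p)
    (hZ : MDifferentiableAt (𝓡 n) (𝓡 n).tangent (T% Z) p) :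
    mvfderiv (𝓡 n) (g.pairing Y Z) p (X p) =
      g.inner p (g.leviCivita Y p (X p)) (Z p) + g.inner p (Y p) (g.leviCivita Z p (X p)) := by
  rw [g.symm p (Y p)]
  refine .trans ?_ (congrArg₂ (· + ·) (g.inner_nablaAux hX hY hZ)
    (g.inner_nablaAux hX hZ hY)).symm
  simp only [koszul, g.pairing_comm Z Y, mlieBracket_swap_apply (V := Z) (W := Y)]
  simp
  ring

/-! ### Curvature -/

/-- The curvature `R(X, Y)Z = ∇_X ∇_Y Z - ∇_Y ∇_X Z - ∇_{[X, Y]} Z` at `p`. -/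
def curvature (X Y Z : Π p : M, TangentSpace (𝓡 n) p) (p : M) : TangentSpace (𝓡 n) p :=
  g.leviCivita (fun q ↦ g.leviCivita Z q (Y q)) p (X p)
    - g.leviCivita (fun q ↦ g.leviCivita Z q (X q)) p (Y p)
    - g.leviCivita Z p (mlieBracket (𝓡 n) X Y p)

/-- The Riemann curvature tensor on tangent vectors, computed with (locally smooth) extensions of
the vectors to vector fields. -/
def riemann (p : M) (u v w : TangentSpace (𝓡 n) p) : TangentSpace (𝓡 n) p :=
  g.curvature (FiberBundle.extend (EuclideanSpace ℝ (Fin n)) u)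
    (FiberBundle.extend (EuclideanSpace ℝ (Fin n)) v)
    (FiberBundle.extend (EuclideanSpace ℝ (Fin n)) w) p

/-- A basis `e₁, …, eₙ` of the tangent space at `p`. -/
def tangentBasis (p : M) : Basis (Fin n) ℝ (TangentSpace (𝓡 n) p) :=
  (EuclideanSpace.basisFun (Fin n) ℝ).toBasis

/-- The Ricci tensor `S(v, w)`, the trace of `u ↦ R(u, v)w`. -/
def ricci (p : M) (v w : TangentSpace (𝓡 n) p) : ℝ :=
  ∑ i, (tangentBasis p).coord i (g.riemann p (tangentBasis p i) v w)

/-- The inverse `(g^{ij})` of the Gram matrix `(g(e_i, e_j))` of the metric at `p`. -/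
def gramInv (p : M) : Matrix (Fin n) (Fin n) ℝ :=
  (Matrix.of fun i j ↦ g.inner p (tangentBasis p i) (tangentBasis p j))⁻¹

/-- The trace `g^{ij} B_{ij}` of a bilinear form with respect to the metric. -/
def metricTrace (p : M) (B : TangentSpace (𝓡 n) p → TangentSpace (𝓡 n) p → ℝ) : ℝ :=
  ∑ i, ∑ j, g.gramInv p i j * B (tangentBasis p i) (tangentBasis p j)

/-- The squared norm `|B|² = g^{ik} g^{jl} B_{ij} B_{kl}` of a bilinear form with respect to the
metric. -/
def normSq (p : M) (B : TangentSpace (𝓡 n) p → TangentSpace (𝓡 n) p → ℝ) : ℝ :=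
  ∑ i, ∑ j, ∑ k, ∑ l, g.gramInv p i k * g.gramInv p j l *
    B (tangentBasis p i) (tangentBasis p j) * B (tangentBasis p k) (tangentBasis p l)

/-- The scalar curvature. -/
def scal (p : M) : ℝ := g.metricTrace p (g.ricci p)

/-! ### Gradient, Hessian, Laplacian -/

/-- The gradient: `g(grad f, v) = df(v)`. -/
def grad (f : M → ℝ) (p : M) : TangentSpace (𝓡 n) p := g.sharp p (mvfderiv (𝓡 n) f p).toLinearMap

/-- The Hessian `Hess f (v, w) = g(∇_v grad f, w)`. -/
def hess (f : M → ℝ) (p : M) (v w : TangentSpace (𝓡 n) p) : ℝ :=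
  g.inner p (g.leviCivita (g.grad f) p v) w

/-- The divergence, the trace of `v ↦ ∇_v X`. -/
def divergence (X : Π p : M, TangentSpace (𝓡 n) p) (p : M) : ℝ :=
  LinearMap.trace ℝ (TangentSpace (𝓡 n) p) (g.leviCivita X p).toLinearMap

/-- The Laplacian `Δ f = div (grad f)`. -/
def laplacian (f : M → ℝ) : M → ℝ := g.divergence (g.grad f)

end PseudoRiemannianMetric

/-- An `(ε)`-almost paracontact metric structure `(φ, ξ, η, g, ε)` on the pseudo-Riemannian manifold
`(M, g)`. -/
structure AlmostParacontactMetricStructure {n : ℕ} {M : Type*} [TopologicalSpace M]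
    [ChartedSpace (EuclideanSpace ℝ (Fin n)) M] [IsManifold (𝓡 n) ∞ M]
    (g : PseudoRiemannianMetric n M) (ε : ℝ) where
  eps_eq : ε = 1 ∨ ε = -1
  /-- The (1,1)-tensor field. -/
  φ (p : M) : TangentSpace (𝓡 n) p →L[ℝ] TangentSpace (𝓡 n) p
  /-- The structure vector field. -/
  ξ (p : M) : TangentSpace (𝓡 n) p
  /-- The 1-form. -/
  η (p : M) : TangentSpace (𝓡 n) p →L[ℝ] ℝ
  φ_contMDiff : ContMDiff (𝓡 n)
    ((𝓡 n).prod 𝓘(ℝ, EuclideanSpace ℝ (Fin n) →L[ℝ] EuclideanSpace ℝ (Fin n))) ∞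
    (fun p ↦ TotalSpace.mk' (EuclideanSpace ℝ (Fin n) →L[ℝ] EuclideanSpace ℝ (Fin n)) p (φ p))
  ξ_contMDiff : ContMDiff (𝓡 n) (𝓡 n).tangent ∞ (T% ξ)
  η_contMDiff : ContMDiff (𝓡 n) ((𝓡 n).prod 𝓘(ℝ, EuclideanSpace ℝ (Fin n) →L[ℝ] ℝ)) ∞
    (fun p ↦ TotalSpace.mk' (EuclideanSpace ℝ (Fin n) →L[ℝ] ℝ) p (η p))
  φ_φ (p : M) (v : TangentSpace (𝓡 n) p) : φ p (φ p v) = v - η p v • ξ p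
  η_ξ (p : M) : η p (ξ p) = 1
  φ_ξ (p : M) : φ p (ξ p) = 0
  η_φ (p : M) (v : TangentSpace (𝓡 n) p) : η p (φ p v) = 0
  inner_φ_φ (p : M) (v w : TangentSpace (𝓡 n) p) :
    g.inner p (φ p v) (φ p w) = g.inner p v w - ε * (η p v * η p w)

/-- The `(ε)`-para Sasakian condition
`(∇_X φ) Y = - g(φ X, φ Y) ξ - ε η(Y) φ² X`, where `(∇_X φ) Y = ∇_X (φ Y) - φ (∇_X Y)`. Being
tensorial in `X` and `Y`, it is stated at every point `p`, for every tangent vector `v` at `p` and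
every vector field `Y` that is smooth near `p`. -/
def AlmostParacontactMetricStructure.IsParaSasakian {n : ℕ} {M : Type*} [TopologicalSpace M]
    [ChartedSpace (EuclideanSpace ℝ (Fin n)) M] [IsManifold (𝓡 n) ∞ M]
    {g : PseudoRiemannianMetric n M} {ε : ℝ} (A : AlmostParacontactMetricStructure g ε) : Prop :=
  ∀ (p : M) (v : TangentSpace (𝓡 n) p) (Y : Π q : M, TangentSpace (𝓡 n) q),
    ContMDiffAt (𝓡 n) (𝓡 n).tangent ∞ (T% Y) p →
    g.leviCivita (fun q ↦ A.φ q (Y q)) p v - A.φ p (g.leviCivita Y p v)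
      = -(g.inner p (A.φ p v) (A.φ p (Y p)) • A.ξ p) - (ε * A.η p (Y p)) • A.φ p (A.φ p v)

/-- The potential function `f` and the functions `lam`, `mu` define a gradient almost `η`-Ricci
soliton on `(M, g)`: `Hess f + S + lam g + mu η ⊗ η = 0`. -/
structure IsGradientAlmostEtaRicciSoliton {n : ℕ} {M : Type*} [TopologicalSpace M]
    [ChartedSpace (EuclideanSpace ℝ (Fin n)) M] [IsManifold (𝓡 n) ∞ M]
    (g : PseudoRiemannianMetric n M) (η : Π p : M, TangentSpace (𝓡 n) p →L[ℝ] ℝ)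
    (f lam mu : M → ℝ) : Prop where
  contMDiff_f : ContMDiff (𝓡 n) 𝓘(ℝ) ∞ f
  contMDiff_lam : ContMDiff (𝓡 n) 𝓘(ℝ) ∞ lam
  contMDiff_mu : ContMDiff (𝓡 n) 𝓘(ℝ) ∞ mu
  equation (p : M) (v w : TangentSpace (𝓡 n) p) :
    g.hess f p v w + g.ricci p v w + lam p * g.inner p v w + mu p * (η p v * η p w) = 0

end

/-! Putting Y = ξ in the para Sasakian condition gives ∇_v ξ = ε φ v
(`IsParaSasakian.leviCivita_ξ`), so with grad f = ξ the Hessian is ε g(φ·,·). The soliton equation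
then determines the Ricci tensor: S = g(Q·,·) with Q = -(ε φ + λ I + ε μ η ⊗ ξ). Hence |S|² = tr Q²
(`normSq_inner_map`) and scal = tr Q (`metricTrace_inner_map`). With T = Δf + εμ these are n - 1 +
μ² + nλ² + 2λT (`trace_ricciOperator_comp_self`) and -(T + nλ). Completing the square in λ gives the
identity |S|² = n - 1 + μ² + scal²/n - T²/n, and each bound drops one of the two squares. No
definiteness of g is needed, since no Cauchy–Schwarz inequality enters. -/

namespace PseudoRiemannianMetric

variable {n : ℕ} {M : Type*} [TopologicalSpace M]
  [ChartedSpace (EuclideanSpace ℝ (Fin n)) M] [IsManifold (𝓡 n) ∞ M]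
  (g : PseudoRiemannianMetric n M)

/-! ### Metric contractions as traces of endomorphisms. -/

/-- The Gram matrix `(g(e_i, e_j))` of the metric at `p`. -/
noncomputable def gram (p : M) : Matrix (Fin n) (Fin n) ℝ :=
  Matrix.of fun i j ↦ g.inner p (tangentBasis p i) (tangentBasis p j)

lemma gram_transpose (p : M) : (g.gram p).transpose = g.gram p := by
  ext i j
  exact g.symm p _ _

/-- A kernel vector c of the Gram matrix makes ∑ c_j e_j orthogonal to every basis vector, hence
zero by nondegeneracy, hence c = 0. -/
lemma isUnit_det_gram (p : M) : IsUnit (g.gram p).det := by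
  rw [isUnit_iff_ne_zero]
  intro h
  obtain ⟨c, hc, hGc⟩ := Matrix.exists_mulVec_eq_zero_iff.mpr h
  apply hc
  have hv : ∑ j, c j • tangentBasis p j = 0 := by
    refine g.nondegenerate p _ fun w ↦ ?_
    have hlin : (g.inner p (∑ j, c j • tangentBasis p j)).toLinearMap = 0 := by
      refine (tangentBasis p).ext fun i ↦ ?_
      have := congrFun hGc i
      rw [ContinuousLinearMap.coe_coe, g.symm p]
      simpa [Matrix.mulVec, dotProduct, gram, mul_comm] using this
    exact LinearMap.congr_fun hlin w
  funext j
  exact (Fintype.linearIndependent_iff.mp (tangentBasis p).linearIndependent) c hv j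

lemma gramInv_eq (p : M) : g.gramInv p = (g.gram p)⁻¹ := rfl

lemma inner_map_tangentBasis (p : M) (L : TangentSpace (𝓡 n) p →ₗ[ℝ] TangentSpace (𝓡 n) p)
    (i j : Fin n) :
    g.inner p (L (tangentBasis p i)) (tangentBasis p j) =
      ((LinearMap.toMatrix (tangentBasis p) (tangentBasis p) L).transpose * g.gram p) i j := by
  conv_lhs => rw [← (tangentBasis p).sum_repr (L (tangentBasis p i))]
  rw [map_sum, sum_apply]
  simp only [map_smul, smul_apply, smul_eq_mul, Matrix.mul_apply, Matrix.transpose_apply,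
    LinearMap.toMatrix_apply, gram, Matrix.of_apply]

/-- The metric trace of the bilinear form `g(L ·, ·)` is the trace of `L`. -/
lemma metricTrace_inner_map (p : M) (L : TangentSpace (𝓡 n) p →ₗ[ℝ] TangentSpace (𝓡 n) p) :
    g.metricTrace p (fun v w ↦ g.inner p (L v) w) = LinearMap.trace ℝ _ L := by
  rw [LinearMap.trace_eq_matrix_trace ℝ (tangentBasis p)]
  set A := LinearMap.toMatrix (tangentBasis p) (tangentBasis p) L with hA
  have h : g.metricTrace p (fun v w ↦ g.inner p (L v) w) =
      ((g.gram p)⁻¹ * (A.transpose * g.gram p).transpose).trace := by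
    simp only [metricTrace, inner_map_tangentBasis, gramInv_eq, Matrix.trace, Matrix.diag_apply,
      Matrix.mul_apply (M := (g.gram p)⁻¹), Matrix.transpose_apply, ← hA]
  rw [h, Matrix.transpose_mul, Matrix.transpose_transpose, gram_transpose, ← Matrix.mul_assoc,
    Matrix.nonsing_inv_mul _ (g.isUnit_det_gram p), Matrix.one_mul]

/-- The squared norm of the bilinear form `g(L ·, ·)` is the trace of `L²` if `L` is
self-adjoint. -/
lemma normSq_inner_map (p : M) (L : TangentSpace (𝓡 n) p →ₗ[ℝ] TangentSpace (𝓡 n) p)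
    (hL : ∀ v w, g.inner p (L v) w = g.inner p v (L w)) :
    g.normSq p (fun v w ↦ g.inner p (L v) w) = LinearMap.trace ℝ _ (L ∘ₗ L) := by
  rw [LinearMap.trace_eq_matrix_trace ℝ (tangentBasis p),
    LinearMap.toMatrix_comp (tangentBasis p) (tangentBasis p) (tangentBasis p)]
  set A := LinearMap.toMatrix (tangentBasis p) (tangentBasis p) L with hA
  set B := A.transpose * g.gram p with hB
  -- Self-adjointness enters here: AᵀG is symmetric, hence equal to GA, so that G⁻¹B = A.
  have hsymm : B.transpose = B := by
    ext i j
    rw [Matrix.transpose_apply, hB, hA, ← inner_map_tangentBasis, ← inner_map_tangentBasis, hL,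
      g.symm p]
  have hGB : (g.gram p)⁻¹ * B = A := by
    rw [← hsymm, hB, Matrix.transpose_mul, Matrix.transpose_transpose, gram_transpose,
      ← Matrix.mul_assoc, Matrix.nonsing_inv_mul _ (g.isUnit_det_gram p), Matrix.one_mul]
  have hGT : ((g.gram p)⁻¹).transpose = (g.gram p)⁻¹ := by
    rw [Matrix.transpose_nonsing_inv, gram_transpose]
  have h : g.normSq p (fun v w ↦ g.inner p (L v) w) =
      (((g.gram p)⁻¹ * B) * ((g.gram p)⁻¹ * B)).trace := by
    -- Symmetry of B and G⁻¹ lets the indices be chained as j, i, k, l, j, which is a diagonal entry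
    -- of B G⁻¹ B G⁻¹.
    have key : ∀ i j k l, g.gramInv p i k * g.gramInv p j l *
        g.inner p (L (tangentBasis p i)) (tangentBasis p j) *
        g.inner p (L (tangentBasis p k)) (tangentBasis p l) =
        B j i * (g.gram p)⁻¹ i k * B k l * (g.gram p)⁻¹ l j := by
      intro i j k l
      rw [inner_map_tangentBasis, inner_map_tangentBasis, ← hA, ← hB, gramInv_eq,
        ← congrFun (congrFun hGT l) j, Matrix.transpose_apply, ← congrFun (congrFun hsymm j) i,
        Matrix.transpose_apply]
      ring
    have hcyc : (((g.gram p)⁻¹ * B) * ((g.gram p)⁻¹ * B)).trace =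
        (B * (g.gram p)⁻¹ * B * (g.gram p)⁻¹).trace := by
      rw [Matrix.mul_assoc, Matrix.trace_mul_comm, ← Matrix.mul_assoc]
    rw [hcyc]
    simp only [normSq, key, Matrix.trace, Matrix.diag_apply, Matrix.mul_apply, Finset.sum_mul]
    rw [Finset.sum_comm]
    refine Finset.sum_congr rfl fun j _ ↦ ?_
    rw [Finset.sum_comm' (t' := Finset.univ) (s' := fun _ ↦ Finset.univ) (by simp)]
    rw [Finset.sum_congr rfl fun k _ ↦ Finset.sum_comm, Finset.sum_comm]
  rw [h, hGB]

end PseudoRiemannianMetric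

/-! ### Pointwise identities of the structure and the derivative of ξ. -/

namespace AlmostParacontactMetricStructure

variable {n : ℕ} {M : Type*} [TopologicalSpace M]
  [ChartedSpace (EuclideanSpace ℝ (Fin n)) M] [IsManifold (𝓡 n) ∞ M]
  {g : PseudoRiemannianMetric n M} {ε : ℝ} (A : AlmostParacontactMetricStructure g ε)

lemma eps_mul_eps (A : AlmostParacontactMetricStructure g ε) : ε * ε = 1 := by
  rcases A.eps_eq with h | h <;> simp [h]

lemma inner_ξ_left (p : M) (w : TangentSpace (𝓡 n) p) :
    g.inner p (A.ξ p) w = ε * A.η p w := by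
  have h := A.inner_φ_φ p (A.ξ p) w
  rw [A.φ_ξ, A.η_ξ] at h
  simp only [map_zero, zero_apply, one_mul] at h
  linarith

/-- Replace w by φw in the compatibility condition; the ξ-part of φ²w is orthogonal to φv. -/
lemma inner_φ_left (p : M) (v w : TangentSpace (𝓡 n) p) :
    g.inner p (A.φ p v) w = g.inner p v (A.φ p w) := by
  have h := A.inner_φ_φ p v (A.φ p w)
  rw [A.φ_φ, A.η_φ, map_sub, map_smul, g.symm p (A.φ p v) (A.ξ p), A.inner_ξ_left, A.η_φ] at h
  simpa using h

/-- The function g(ξ, ξ) = ε is constant, so metric compatibility gives 2 g(∇_v ξ, ξ) = 0. -/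
lemma η_leviCivita_ξ (p : M) (v : TangentSpace (𝓡 n) p) :
    A.η p (g.leviCivita A.ξ p v) = 0 := by
  have hξ : MDifferentiableAt (𝓡 n) (𝓡 n).tangent (T% A.ξ) p :=
    A.ξ_contMDiff.mdifferentiable (by simp) p
  have hX : MDifferentiableAt (𝓡 n) (𝓡 n).tangent
      (T% (FiberBundle.extend (EuclideanSpace ℝ (Fin n)) v :
        Π q : M, TangentSpace (𝓡 n) q)) p :=
    FiberBundle.mdifferentiableAt_extend ..
  have h := g.leviCivita_metric hX hξ hξ
  have hc : g.pairing A.ξ A.ξ = fun _ ↦ ε := by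
    funext q
    rw [PseudoRiemannianMetric.pairing, A.inner_ξ_left, A.η_ξ, mul_one]
  rw [hc, mvfderiv_const, g.symm p _ (A.ξ p), A.inner_ξ_left, FiberBundle.extend_apply_self] at h
  have hε : ε ≠ 0 := fun h0 ↦ by simpa [h0] using A.eps_mul_eps
  have h' : ε * A.η p (g.leviCivita A.ξ p v) = 0 := by
    simp only [zero_apply] at h
    linarith
  exact (mul_eq_zero.mp h').resolve_left hε

/-- On an `(ε)`-para Sasakian manifold, `∇_v ξ = ε φ v`. -/
lemma IsParaSasakian.leviCivita_ξ {A : AlmostParacontactMetricStructure g ε}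
    (hA : A.IsParaSasakian) (p : M) (v : TangentSpace (𝓡 n) p) :
    g.leviCivita A.ξ p v = ε • A.φ p v := by
  have h := hA p v A.ξ A.ξ_contMDiff.contMDiffAt
  have h0 : (fun q ↦ A.φ q (A.ξ q)) = 0 := funext fun q ↦ A.φ_ξ q
  have h1 : A.φ p (g.leviCivita A.ξ p v) = ε • A.φ p (A.φ p v) := by
    rw [h0, CovariantDerivative.zero, A.φ_ξ, A.η_ξ] at h
    simpa using h
  -- A second φ makes φ² act on ∇_v ξ and on φv, both annihilated by η, where φ² is the identity.
  have h2 := congrArg (A.φ p) h1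
  rw [map_smul, A.φ_φ p (A.φ p v), A.φ_φ, A.η_leviCivita_ξ, A.η_φ] at h2
  simpa using h2

lemma trace_φ_φ (p : M) :
    LinearMap.trace ℝ _ ((A.φ p).toLinearMap ∘ₗ (A.φ p).toLinearMap) = (n : ℝ) - 1 := by
  have h : (A.φ p).toLinearMap ∘ₗ (A.φ p).toLinearMap =
      LinearMap.id - (A.η p).toLinearMap.smulRight (A.ξ p) := by
    ext1 v
    exact A.φ_φ p v
  have hn : finrank ℝ (TangentSpace (𝓡 n) p) = n :=
    (finrank_eq_card_basis (PseudoRiemannianMetric.tangentBasis p)).trans (Fintype.card_fin n)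
  rw [h, map_sub, LinearMap.trace_id, LinearMap.trace_smulRight, hn]
  simp [A.η_ξ]

/-- Since η(ξ) = 1, ξ is nonzero; this makes the division by n in the bounds genuine. -/
lemma dim_pos (A : AlmostParacontactMetricStructure g ε) (p : M) : 0 < n := by
  rcases Nat.eq_zero_or_pos n with rfl | h
  · have : A.ξ p = 0 := (PseudoRiemannianMetric.tangentBasis p).ext_elem fun i ↦ i.elim0
    simpa [this] using A.η_ξ p
  · exact h

end AlmostParacontactMetricStructure

/-! ### The Ricci operator and its traces. -/

/-- The endomorphism `-(ε φ + a I + b ε η ⊗ ξ)`. -/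
noncomputable def AlmostParacontactMetricStructure.ricciOperator {n : ℕ} {M : Type*} [TopologicalSpace M]
    [ChartedSpace (EuclideanSpace ℝ (Fin n)) M] [IsManifold (𝓡 n) ∞ M]
    {g : PseudoRiemannianMetric n M} {ε : ℝ} (A : AlmostParacontactMetricStructure g ε)
    (a b : ℝ) (p : M) : TangentSpace (𝓡 n) p →ₗ[ℝ] TangentSpace (𝓡 n) p :=
  -(ε • (A.φ p).toLinearMap + a • LinearMap.id +
    (b * ε) • (A.η p).toLinearMap.smulRight (A.ξ p))

namespace AlmostParacontactMetricStructure

variable {n : ℕ} {M : Type*} [TopologicalSpace M]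
  [ChartedSpace (EuclideanSpace ℝ (Fin n)) M] [IsManifold (𝓡 n) ∞ M]
  {g : PseudoRiemannianMetric n M} {ε : ℝ} (A : AlmostParacontactMetricStructure g ε)

lemma ricciOperator_apply (a b : ℝ) (p : M) (v : TangentSpace (𝓡 n) p) :
    A.ricciOperator a b p v =
      -(ε • A.φ p v + a • v + (b * ε) • (A.η p v • A.ξ p)) := rfl

/-- The factor ε on η ⊗ ξ cancels the one in g(ξ, ·) = ε η. -/
lemma inner_ricciOperator (a b : ℝ) (p : M) (v w : TangentSpace (𝓡 n) p) :
    g.inner p (A.ricciOperator a b p v) w =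
      -(ε * g.inner p (A.φ p v) w + a * g.inner p v w + b * (A.η p v * A.η p w)) := by
  have h := A.eps_mul_eps
  rw [ricciOperator_apply]
  simp only [map_neg, map_add, map_smul, neg_apply,
    add_apply, smul_apply, smul_eq_mul, A.inner_ξ_left]
  linear_combination (-(b * A.η p v * A.η p w)) * h

lemma ricciOperator_selfAdjoint (a b : ℝ) (p : M) (v w : TangentSpace (𝓡 n) p) :
    g.inner p (A.ricciOperator a b p v) w = g.inner p v (A.ricciOperator a b p w) := by
  rw [g.symm p v, inner_ricciOperator, inner_ricciOperator, A.inner_φ_left, g.symm p v (A.φ p w),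
    g.symm p v w]
  ring

lemma trace_ricciOperator (a b : ℝ) (p : M) :
    LinearMap.trace ℝ _ (A.ricciOperator a b p) =
      -(ε * LinearMap.trace ℝ _ (A.φ p).toLinearMap + n * a + ε * b) := by
  have hn : finrank ℝ (TangentSpace (𝓡 n) p) = n :=
    (finrank_eq_card_basis (PseudoRiemannianMetric.tangentBasis p)).trans (Fintype.card_fin n)
  simp only [ricciOperator, map_neg, map_add, map_smul, LinearMap.trace_id,
    LinearMap.trace_smulRight, hn, smul_eq_mul]
  simp [A.η_ξ]
  ring

/-- The products of φ with η ⊗ ξ vanish because φξ = 0 and η ∘ φ = 0, while η ⊗ ξ is idempotent of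
trace 1 and tr φ² = n - 1. -/
lemma trace_ricciOperator_comp_self (a b : ℝ) (p : M) :
    LinearMap.trace ℝ _ (A.ricciOperator a b p ∘ₗ A.ricciOperator a b p) =
      (n : ℝ) - 1 + b ^ 2 + n * a ^ 2 +
        2 * a * (ε * LinearMap.trace ℝ _ (A.φ p).toLinearMap + ε * b) := by
  have h := A.eps_mul_eps
  have hn : finrank ℝ (TangentSpace (𝓡 n) p) = n :=
    (finrank_eq_card_basis (PseudoRiemannianMetric.tangentBasis p)).trans (Fintype.card_fin n)
  have hsq : A.ricciOperator a b p ∘ₗ A.ricciOperator a b p =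
      (A.φ p).toLinearMap ∘ₗ (A.φ p).toLinearMap + a ^ 2 • LinearMap.id +
        (2 * a * ε) • (A.φ p).toLinearMap +
        (b ^ 2 + 2 * a * b * ε) • (A.η p).toLinearMap.smulRight (A.ξ p) := by
    ext1 v
    simp only [LinearMap.comp_apply, ricciOperator_apply, LinearMap.add_apply,
      LinearMap.smul_apply, LinearMap.id_apply, LinearMap.smulRight_apply,
      ContinuousLinearMap.coe_coe, map_neg, map_add, map_smul, A.φ_ξ, A.η_φ, A.η_ξ]
    have h' : ε ^ 2 = 1 := by rw [sq, h]
    match_scalars <;> ring_nf <;> simp only [h'] <;> ring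
  rw [hsq]
  simp only [map_add, map_smul, A.trace_φ_φ, LinearMap.trace_id,
    LinearMap.trace_smulRight, hn, smul_eq_mul]
  simp [A.η_ξ]
  ring

end AlmostParacontactMetricStructure

/-! ### The two bounds. -/

theorem mainTheorem2 {n : ℕ} {M : Type*} [TopologicalSpace M]
    [ChartedSpace (EuclideanSpace ℝ (Fin n)) M] [IsManifold (𝓡 n) ∞ M]
    (g : PseudoRiemannianMetric n M) (ε : ℝ) (A : AlmostParacontactMetricStructure g ε)
    (hA : A.IsParaSasakian) (f lam mu : M → ℝ)
    (hξ : ∀ p, A.ξ p = g.grad f p)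
    (hsol : IsGradientAlmostEtaRicciSoliton g A.η f lam mu) (p : M) :
    (n : ℝ) - 1 + mu p ^ 2 - (g.laplacian f p + ε * mu p) ^ 2 / n ≤ g.normSq p (g.ricci p) ∧
      g.normSq p (g.ricci p) ≤ (n : ℝ) - 1 + mu p ^ 2 + g.scal p ^ 2 / n := by
  have hgrad : g.grad f = A.ξ := (funext hξ).symm
  have hric : g.ricci p = fun v w ↦ g.inner p (A.ricciOperator (lam p) (mu p) p v) w := by
    funext v w
    have h := hsol.equation p v w
    rw [PseudoRiemannianMetric.hess, hgrad, hA.leviCivita_ξ, map_smul,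
      smul_apply, smul_eq_mul] at h
    rw [A.inner_ricciOperator]
    linarith
  have hlap : g.laplacian f p = ε * LinearMap.trace ℝ _ (A.φ p).toLinearMap := by
    have hnabla : (g.leviCivita A.ξ p).toLinearMap = ε • (A.φ p).toLinearMap := by
      ext1 v
      exact hA.leviCivita_ξ p v
    rw [PseudoRiemannianMetric.laplacian, hgrad, PseudoRiemannianMetric.divergence, hnabla,
      map_smul, smul_eq_mul]
  have hscal : g.scal p = -(g.laplacian f p + n * lam p + ε * mu p) := by
    rw [PseudoRiemannianMetric.scal, hric, g.metricTrace_inner_map, A.trace_ricciOperator, hlap]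
  have hnorm : g.normSq p (g.ricci p) = (n : ℝ) - 1 + mu p ^ 2 + n * lam p ^ 2 +
      2 * lam p * (g.laplacian f p + ε * mu p) := by
    rw [hric, g.normSq_inner_map p _ (A.ricciOperator_selfAdjoint _ _ p),
      A.trace_ricciOperator_comp_self, hlap]
  have hn : (0 : ℝ) < n := Nat.cast_pos.mpr (A.dim_pos p)
  set T := g.laplacian f p + ε * mu p
  -- Completion of the square in λ: the left side is scal²/n, and the last two terms on the right
  -- are those of |S|².
  have hexp : (T + n * lam p) ^ 2 / n = T ^ 2 / n + 2 * lam p * T + n * lam p ^ 2 := by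
    field_simp
    ring
  have hscal' : g.scal p ^ 2 / n = (T + n * lam p) ^ 2 / n := by
    rw [hscal]
    congr 1
    ring
  -- Discarding this square gives the lower bound; discarding the next gives the upper one.
  have h1 : 0 ≤ (T + n * lam p) ^ 2 / n := by positivity
  have h2 : 0 ≤ T ^ 2 / n := by positivity
  rw [hnorm, hscal']
  constructor <;> linarith
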